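/- Consider the continuous piecewise linear system $\dot x=A^+x$ for $x_1\ge 0$, $\dot x=A^-x$ for $x_1<0$, $x=(x_1,x_2,x_3)^T\in\mathbb R^3$, where $$A^\pm=\begin{pmatrix}\delta^\pm&-1&0\\ m^\pm&0&-1\\ d^\pm&0&0\end{pmatrix}$$ are real matrices with eigenvalues $\lambda^\pm\in\mathbb R$ and $\alpha^\pm\pm i\beta^\pm$, $\beta^\pm>0$. Put $\gamma^\pm=(\alpha^\pm-\lambda^\pm)/\beta^\pm$. An invariant cone is a set $C=\{\Phi(p,t):p\in l,\ 0\le t\le T\}$, where $\Phi$ is the flow of the system, $l$ is an open half-line with endpoint $0$ and $T>0$ is such that the solution from every $p\in l$ returns to $l$ for the first time at $t=T$. It is two-zonal if it crosses the plane $x_1=0$, i.e. has points with $x_1>0$ and points with $x_1<0$. The dynamics on $C$ is of center type if every solution starting in $C$ is periodic, of stable focus type if every solution starting in $C$ tends to $0$ as $t\to+\infty$, and of unstable focus type if every solution starting in $C$ tends to $0$ as $t\to-\infty$. The focus plane of $A^\pm$ is the two-dimensional invariant subspace $\ker\big((A^\pm-\alpha^\pm I)^2+(\beta^\pm)^2I\big)$.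 (a) Let $\gamma^+=\gamma^-=0$. A two-zonal invariant cone exists if and only if $\lambda^+=\lambda^-$, and on every two-zonal invariant cone the dynamics is of center type if and only if $\lambda^+=\lambda^-=0$, of stable focus type if and only if $\lambda^+=\lambda^-<0$, and of unstable focus type if and only if $\lambda^+=\lambda^->0$. (b) Suppose that the focus planes of $A^+$ and $A^-$ coincide. Then the common focus plane without the origin is a two-zonal invariant cone (the trivial one), and the dynamics on it is of center type if and only if $\frac{\alpha^+}{\beta^+}+\frac{\alpha^-}{\beta^-}=0$, of stable focus type if and only if this sum is $<0$, and of unstable focus type if and only if this sum is $>0$. -/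

import Mathlib

open Set Filter Topology Polynomial

/-- The matrix in observable canonical form with coefficients `δ, m, d`. -/
def obsMatrix (δ m d : ℝ) : Matrix (Fin 3) (Fin 3) ℝ :=
  !![δ, -1, 0; m, 0, -1; d, 0, 0]

/-- The eigenvalues of the real matrix `A`, with algebraic multiplicity, are
`l`, `a + b i` and `a - b i`. -/
def HasEigenvalues (A : Matrix (Fin 3) (Fin 3) ℝ) (l a b : ℝ) : Prop :=
  (A.map (algebraMap ℝ ℂ)).charpoly.roots =
    {(l : ℂ), (a : ℂ) + (b : ℂ) * Complex.I, (a : ℂ) - (b : ℂ) * Complex.I}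

/-- The parameter `γ = (α - λ) / β`. -/
noncomputable def gammaParam (l a b : ℝ) : ℝ := (a - l) / b

/-- The two-zone piecewise linear vector field: `A⁺ x` where `x₁ ≥ 0`, `A⁻ x` where `x₁ < 0`
(the coordinate `x₁` is `x 0`). -/
noncomputable def pwlField (Ap Am : Matrix (Fin 3) (Fin 3) ℝ) (x : Fin 3 → ℝ) : Fin 3 → ℝ :=
  if 0 ≤ x 0 then Ap.mulVec x else Am.mulVec x

/-- `x` is a (global) solution of the piecewise linear system. -/
def IsPWLSolution (Ap Am : Matrix (Fin 3) (Fin 3) ℝ) (x : ℝ → Fin 3 → ℝ) : Prop :=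
  ∀ t : ℝ, HasDerivAt x (pwlField Ap Am (x t)) t

/-- The half-line from the origin through `v`, without its endpoint. -/
def halfLine (v : Fin 3 → ℝ) : Set (Fin 3 → ℝ) := {p | ∃ r : ℝ, 0 < r ∧ p = r • v}

/-- `C` is an invariant cone: for some half-line `l` and some `T > 0`, the solution from
every point of `l` returns to `l` for the first time at time `T`, and `C` is the surface
swept out by `l` during the time interval `[0, T]` (the apex is not counted as a point of `C`). -/
def IsInvariantCone (Ap Am : Matrix (Fin 3) (Fin 3) ℝ) (C : Set (Fin 3 → ℝ)) : Prop :=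
  ∃ v : Fin 3 → ℝ, v ≠ 0 ∧ ∃ T : ℝ, 0 < T ∧
    (∀ p ∈ halfLine v, ∃ x : ℝ → Fin 3 → ℝ, IsPWLSolution Ap Am x ∧ x 0 = p ∧
      x T ∈ halfLine v ∧ ∀ t ∈ Ioo 0 T, x t ∉ halfLine v) ∧
    C = {q | ∃ x : ℝ → Fin 3 → ℝ, IsPWLSolution Ap Am x ∧ x 0 ∈ halfLine v ∧
      ∃ t ∈ Icc 0 T, x t = q}

/-- A two-zonal invariant cone: one that crosses the separation plane `x₁ = 0`,
that is, has points in both open zones. -/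
def IsTwoZonalInvariantCone (Ap Am : Matrix (Fin 3) (Fin 3) ℝ) (C : Set (Fin 3 → ℝ)) : Prop :=
  IsInvariantCone Ap Am C ∧ (∃ p ∈ C, 0 < p 0) ∧ (∃ p ∈ C, p 0 < 0)

/-- Center type: every solution on `C` is periodic. (An invariant cone contains no
equilibrium, so these are genuine periodic orbits.) -/
def IsCenterOn (Ap Am : Matrix (Fin 3) (Fin 3) ℝ) (C : Set (Fin 3 → ℝ)) : Prop :=
  ∀ x : ℝ → Fin 3 → ℝ, IsPWLSolution Ap Am x → x 0 ∈ C → ∃ P : ℝ, 0 < P ∧ ∀ t, x (t + P) = x t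

/-- Stable focus type: every solution on `C` tends to the origin in forward time. (On an
invariant cone it does so while winding around the cone.) -/
def IsStableFocusOn (Ap Am : Matrix (Fin 3) (Fin 3) ℝ) (C : Set (Fin 3 → ℝ)) : Prop :=
  ∀ x : ℝ → Fin 3 → ℝ, IsPWLSolution Ap Am x → x 0 ∈ C → Tendsto x atTop (𝓝 0)

/-- Unstable focus type: every solution on `C` tends to the origin in backward time. -/
def IsUnstableFocusOn (Ap Am : Matrix (Fin 3) (Fin 3) ℝ) (C : Set (Fin 3 → ℝ)) : Prop :=
  ∀ x : ℝ → Fin 3 → ℝ, IsPWLSolution Ap Am x → x 0 ∈ C → Tendsto x atBot (𝓝 0)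

/-- The focus plane of `A`: the real invariant plane belonging to the pair of eigenvalues
`a ± b i`, that is, the kernel of `(A - a)² + b²`. -/
def focusPlane (A : Matrix (Fin 3) (Fin 3) ℝ) (a b : ℝ) : Submodule ℝ (Fin 3 → ℝ) :=
  LinearMap.ker (Matrix.mulVecLin ((A - a • (1 : Matrix (Fin 3) (Fin 3) ℝ)) ^ 2
    + b ^ 2 • (1 : Matrix (Fin 3) (Fin 3) ℝ)))

/-! The left eigenvector (λ², -λ, 1) of each matrix governs both parts: along a linear orbit c =
λ²x₁ - λx₂ + x₃ grows like e^{λt}, and its kernel is the focus plane.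

(a) If γ = 0, then u = e^{-λt}x₁ is a harmonic oscillator u'' + β²u = const. By its reflection
symmetry it returns to u = 0 with the opposite velocity, so a passage of duration τ through one zone
sends (0, x₂, x₃) to e^{λτ}(0, -x₂, x₃ - 2λx₂) (`half_return`). After a passage through both zones
the ratio x₃/x₂ has been shifted by the constant 2(λ⁻ - λ⁺) (`full_return`). On an invariant cone
this ratio stays bounded, so λ⁺ = λ⁻ (`eigenvalues_eq`). Then the full return is a pure rescaling by
e^{λP}, where P is its duration, and the sign of λ decides the type. Conversely, equal λ make the
focus planes coincide, and (b) supplies a cone.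

(b) In the common plane a half turn takes the time π/β and multiplies the crossing point by
-e^{πα/β}. Hence a full turn multiplies by exp(π(α⁺/β⁺ + α⁻/β⁻)), whose exponent decides the type.
In both parts the conclusion comes from `focus_type_of_self_similar`, applied to orbits with x(t +
P) = e^{σP}x(t). -/

theorem HasEigenvalues.coeffs {δ m d l a b : ℝ} (h : HasEigenvalues (obsMatrix δ m d) l a b) :
    δ = l + 2 * a ∧ m = 2 * l * a + (a ^ 2 + b ^ 2) ∧ d = l * (a ^ 2 + b ^ 2) := by
  have key : ∀ x : ℝ, x ^ 3 - δ * x ^ 2 + m * x - d = (x - l) * ((x - a) ^ 2 + b ^ 2) := by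
    intro x
    have h1 := (IsAlgClosed.splits
      ((obsMatrix δ m d).map (algebraMap ℝ ℂ)).charpoly).eval_eq_prod_roots_of_monic
      (Matrix.charpoly_monic _) (x : ℂ)
    rw [h, Matrix.eval_charpoly] at h1
    simp [obsMatrix, Matrix.det_fin_three] at h1
    have h2 : ((x ^ 3 - δ * x ^ 2 + m * x - d : ℝ) : ℂ)
        = (((x - l) * ((x - a) ^ 2 + b ^ 2) : ℝ) : ℂ) := by
      push_cast
      linear_combination h1 - (x - l) * (b : ℂ) ^ 2 * Complex.I_sq
    exact_mod_cast h2
  -- Two monic cubics that agree at 0, 1 and -1 have the same three lower coefficients.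
  have h0 := key 0
  have h1 := key 1
  have h2 := key (-1)
  refine ⟨by linarith, by linarith, by linarith⟩

/-! ### The piecewise linear field: homogeneity, point symmetry, uniqueness -/

theorem obsMatrix_mulVec (δ m d : ℝ) (x : Fin 3 → ℝ) :
    (obsMatrix δ m d).mulVec x = ![δ * x 0 - x 1, m * x 0 - x 2, d * x 0] := by
  ext i
  fin_cases i <;> simp [obsMatrix, Matrix.mulVec, dotProduct, Fin.sum_univ_three] <;> ring

theorem pwlField_smul (A B : Matrix (Fin 3) (Fin 3) ℝ) {r : ℝ} (hr : 0 < r) (x : Fin 3 → ℝ) :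
    pwlField A B (r • x) = r • pwlField A B x := by
  unfold pwlField
  simp only [Pi.smul_apply, smul_eq_mul, mul_nonneg_iff_of_pos_left hr, Matrix.mulVec_smul]
  split_ifs <;> rfl

section
variable {δp mp dp δm mm dm : ℝ}

/-- The matrices differ only in their first column, so they agree on x₁ = 0 and it does not matter
which zone owns that plane. This reduces the zone x₁ ≤ 0 to the zone x₁ ≥ 0. -/
theorem pwlField_neg (x : Fin 3 → ℝ) :
    pwlField (obsMatrix δp mp dp) (obsMatrix δm mm dm) (-x)
      = -pwlField (obsMatrix δm mm dm) (obsMatrix δp mp dp) x := by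
  unfold pwlField
  rcases lt_trichotomy (x 0) 0 with h | h | h
  · simp [h.not_ge, h.le, Matrix.mulVec_neg]
  · simp [h, obsMatrix_mulVec]
  · simp [h.not_ge, h.le, Matrix.mulVec_neg]

theorem pwlField_eq_add_max (x : Fin 3 → ℝ) :
    pwlField (obsMatrix δp mp dp) (obsMatrix δm mm dm) x
      = (obsMatrix δm mm dm).mulVec x + max (x 0) 0 • ![δp - δm, mp - mm, dp - dm] := by
  unfold pwlField
  split_ifs with h
  · rw [max_eq_left h, obsMatrix_mulVec, obsMatrix_mulVec]
    ext i
    fin_cases i <;> simp <;> ring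
  · rw [max_eq_right (not_le.1 h).le]
    simp

theorem exists_lipschitzWith_pwlField :
    ∃ K, LipschitzWith K (pwlField (obsMatrix δp mp dp) (obsMatrix δm mm dm)) := by
  have h1 := (LinearMap.toContinuousLinearMap (obsMatrix δm mm dm).mulVecLin).lipschitz
  have h2 := ((ContinuousLinearMap.id ℝ ℝ).smulRight ![δp - δm, mp - mm, dp - dm]).lipschitz
  have h3 : LipschitzWith 1 (fun x : Fin 3 → ℝ => max (x 0) 0) :=
    (LipschitzWith.eval (α := fun _ : Fin 3 => ℝ) 0).max_const 0
  rw [show pwlField (obsMatrix δp mp dp) (obsMatrix δm mm dm) = _ from funext pwlField_eq_add_max]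
  exact ⟨_, h1.add (h2.comp h3)⟩

theorem IsPWLSolution.smul {A B : Matrix (Fin 3) (Fin 3) ℝ} {x : ℝ → Fin 3 → ℝ}
    (h : IsPWLSolution A B x) {r : ℝ} (hr : 0 < r) : IsPWLSolution A B (fun t => r • x t) := by
  intro t
  rw [pwlField_smul A B hr]
  exact (h t).const_smul r

theorem IsPWLSolution.comp_add {A B : Matrix (Fin 3) (Fin 3) ℝ} {x : ℝ → Fin 3 → ℝ}
    (h : IsPWLSolution A B x) (s : ℝ) : IsPWLSolution A B (fun t => x (t + s)) :=
  fun t => (h (t + s)).comp_add_const t s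

theorem IsPWLSolution.continuous {A B : Matrix (Fin 3) (Fin 3) ℝ} {x : ℝ → Fin 3 → ℝ}
    (h : IsPWLSolution A B x) : Continuous x :=
  continuous_iff_continuousAt.2 fun t => (h t).continuousAt

theorem IsPWLSolution.neg {x : ℝ → Fin 3 → ℝ}
    (h : IsPWLSolution (obsMatrix δp mp dp) (obsMatrix δm mm dm) x) :
    IsPWLSolution (obsMatrix δm mm dm) (obsMatrix δp mp dp) (fun t => -x t) := by
  intro t
  rw [pwlField_neg]
  exact (h t).neg

theorem IsPWLSolution.unique {x y : ℝ → Fin 3 → ℝ}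
    (hx : IsPWLSolution (obsMatrix δp mp dp) (obsMatrix δm mm dm) x)
    (hy : IsPWLSolution (obsMatrix δp mp dp) (obsMatrix δm mm dm) y) {a : ℝ} (h : x a = y a) :
    x = y := by
  obtain ⟨K, hK⟩ := exists_lipschitzWith_pwlField (δp := δp) (mp := mp) (dp := dp) (δm := δm)
    (mm := mm) (dm := dm)
  exact ODE_solution_unique_univ (v := fun _ => pwlField _ _) (s := fun _ => univ)
    (fun _ => hK.lipschitzOnWith) (fun t => ⟨hx t, trivial⟩) (fun t => ⟨hy t, trivial⟩) h

theorem isPWLSolution_zero (A B : Matrix (Fin 3) (Fin 3) ℝ) : IsPWLSolution A B (fun _ => 0) := by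
  intro t
  simpa [pwlField] using hasDerivAt_const t (0 : Fin 3 → ℝ)

theorem IsPWLSolution.ne_zero {x : ℝ → Fin 3 → ℝ}
    (hx : IsPWLSolution (obsMatrix δp mp dp) (obsMatrix δm mm dm) x) {a : ℝ} (h : x a ≠ 0) (t : ℝ) :
    x t ≠ 0 := by
  intro h0
  exact h (congrFun (hx.unique (isPWLSolution_zero _ _) (a := t) h0) a)

/-- A solution that is at `r • x (a + s)` at time `a` is the rescaled and shifted solution. -/
theorem IsPWLSolution.eq_smul_shift {x y : ℝ → Fin 3 → ℝ}
    (hy : IsPWLSolution (obsMatrix δp mp dp) (obsMatrix δm mm dm) y)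
    (hx : IsPWLSolution (obsMatrix δp mp dp) (obsMatrix δm mm dm) x) {r a s : ℝ} (hr : 0 < r)
    (h : y a = r • x (a + s)) (t : ℝ) : y t = r • x (t + s) :=
  congrFun (hy.unique ((hx.comp_add s).smul hr) (a := a) h) t

/-- Turns explicit linear orbits into pieces of piecewise linear ones: while the linear orbit stays
in x₁ ≥ 0 it solves the full system, and uniqueness applies. -/
theorem IsPWLSolution.eqOn_of_linear {x z : ℝ → Fin 3 → ℝ}
    (hx : IsPWLSolution (obsMatrix δp mp dp) (obsMatrix δm mm dm) x)
    (hz : ∀ t, HasDerivAt z ((obsMatrix δp mp dp).mulVec (z t)) t) {a c : ℝ} (h0 : x a = z 0)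
    (hc : ∀ t ∈ Icc 0 c, 0 ≤ z t 0) : ∀ t ∈ Icc 0 c, x (t + a) = z t := by
  obtain ⟨K, hK⟩ := exists_lipschitzWith_pwlField (δp := δp) (mp := mp) (dp := dp) (δm := δm)
    (mm := mm) (dm := dm)
  refine ODE_solution_unique (v := fun _ => pwlField _ _) (fun _ => hK)
    (hx.comp_add a).continuous.continuousOn (fun t _ => (hx.comp_add a t).hasDerivWithinAt)
    (continuous_iff_continuousAt.2 fun t => (hz t).continuousAt).continuousOn ?_ (by simpa using h0)
  intro t ht
  have := (hz t).hasDerivWithinAt (s := Ici t)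
  rwa [pwlField, if_pos (hc t (Ico_subset_Icc_self ht))]

end

/-! ### Growth rate and type of dynamics -/

/-- Trichotomy for solutions that reproduce themselves with growth rate `σ`. -/
theorem focus_type_of_self_similar {A B : Matrix (Fin 3) (Fin 3) ℝ} {C : Set (Fin 3 → ℝ)} {σ : ℝ}
    (hC : ∃ x, IsPWLSolution A B x ∧ x 0 ∈ C ∧ x 0 ≠ 0)
    (h : ∀ x, IsPWLSolution A B x → x 0 ∈ C →
      ∃ P, 0 < P ∧ ∀ t, x (t + P) = Real.exp (σ * P) • x t) :
    (IsCenterOn A B C ↔ σ = 0) ∧ (IsStableFocusOn A B C ↔ σ < 0) ∧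
      (IsUnstableFocusOn A B C ↔ 0 < σ) := by
  obtain ⟨x, hx, hxC, hx0⟩ := hC
  -- The function e^{-σt}x(t) is continuous and P-periodic, hence bounded.
  have bounded : ∀ x, IsPWLSolution A B x → x 0 ∈ C →
      ∃ M, ∀ t, ‖x t‖ ≤ M * Real.exp (σ * t) := by
    intro x hx hxC
    obtain ⟨P, hP, hxP⟩ := h x hx hxC
    have hper : Function.Periodic (fun t => Real.exp (-(σ * t)) • x t) P := by
      intro t
      simp only [hxP, smul_smul, ← Real.exp_add]
      congr 2
      ring
    have hcont : Continuous (fun t => Real.exp (-(σ * t)) • x t) := by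
      have := hx.continuous
      fun_prop
    obtain ⟨M, hM⟩ := (hper.isBounded_of_continuous hP.ne' hcont).exists_norm_le
    refine ⟨M, fun t => ?_⟩
    have := hM _ (mem_range_self t)
    rw [norm_smul, Real.norm_eq_abs, Real.abs_exp, Real.exp_neg, inv_mul_le_iff₀ (Real.exp_pos _)]
      at this
    linarith
  have c1 : σ = 0 → IsCenterOn A B C := by
    intro hσ x hx hxC
    obtain ⟨P, hP, hxP⟩ := h x hx hxC
    exact ⟨P, hP, fun t => by simpa [hσ] using hxP t⟩
  have c2 : σ < 0 → IsStableFocusOn A B C := by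
    intro hσ x hx hxC
    obtain ⟨M, hM⟩ := bounded x hx hxC
    refine squeeze_zero_norm hM ?_
    have := Real.tendsto_exp_atBot.comp ((tendsto_id (α := ℝ)).const_mul_atTop_of_neg hσ)
    simpa using this.const_mul M
  have c3 : 0 < σ → IsUnstableFocusOn A B C := by
    intro hσ x hx hxC
    obtain ⟨M, hM⟩ := bounded x hx hxC
    refine squeeze_zero_norm hM ?_
    have := Real.tendsto_exp_atBot.comp ((tendsto_id (α := ℝ)).const_mul_atBot hσ)
    simpa using this.const_mul M
  obtain ⟨P, hP, hxP⟩ := h x hx hxC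
  have n1 : ∀ n : ℕ, x (n * P) = Real.exp (n * (σ * P)) • x 0 := by
    intro n
    induction n with
    | zero => simp
    | succ n ih =>
      have := hxP (n * P)
      rw [ih, smul_smul, ← Real.exp_add] at this
      push_cast
      rw [add_mul, one_mul, this]
      congr 2
      ring
  have n2 : ∀ n : ℕ, x (-(n * P)) = Real.exp (-(n * (σ * P))) • x 0 := by
    intro n
    induction n with
    | zero => simp
    | succ n ih =>
      have := hxP (-((n + 1 : ℕ) * P))
      rw [show -(((n + 1 : ℕ) : ℝ) * P) + P = -(n * P) by push_cast; ring, ih] at this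
      rw [← inv_smul_eq_iff₀ (Real.exp_pos _).ne', ← Real.exp_neg, smul_smul, ← Real.exp_add] at this
      rw [← this]
      congr 2
      push_cast
      ring
  -- Along the times nP the norm never drops below ‖x 0‖ > 0; `s2` is the same in backward time.
  have s1 : 0 ≤ σ → ¬ IsStableFocusOn A B C := by
    intro hσ hs
    have t1 := (hs x hx hxC).comp (tendsto_natCast_atTop_atTop.atTop_mul_const hP)
    have t2 := t1.norm
    rw [norm_zero] at t2
    refine absurd (ge_of_tendsto' t2 (b := ‖x 0‖) fun n => ?_) (by simpa using hx0)
    simp only [Function.comp, n1, norm_smul, Real.norm_eq_abs, Real.abs_exp]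
    exact le_mul_of_one_le_left (norm_nonneg _) (Real.one_le_exp (by positivity))
  have s2 : σ ≤ 0 → ¬ IsUnstableFocusOn A B C := by
    intro hσ hs
    have t1 := (hs x hx hxC).comp
      (tendsto_neg_atTop_atBot.comp (tendsto_natCast_atTop_atTop.atTop_mul_const hP))
    have t2 := t1.norm
    rw [norm_zero] at t2
    refine absurd (ge_of_tendsto' t2 (b := ‖x 0‖) fun n => ?_) (by simpa using hx0)
    simp only [Function.comp, n2, norm_smul, Real.norm_eq_abs, Real.abs_exp]
    refine le_mul_of_one_le_left (norm_nonneg _) (Real.one_le_exp ?_)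
    have : (n : ℝ) * (σ * P) ≤ 0 :=
      mul_nonpos_of_nonneg_of_nonpos n.cast_nonneg (mul_nonpos_of_nonpos_of_nonneg hσ hP.le)
    linarith
  have s3 : IsCenterOn A B C → ¬ IsStableFocusOn A B C ∧ ¬ IsUnstableFocusOn A B C := by
    intro hc
    obtain ⟨Q, hQ, hxQ⟩ := hc x hx hxC
    have hper : Function.Periodic x Q := hxQ
    constructor
    · intro hs
      have t1 := (hs x hx hxC).comp (tendsto_natCast_atTop_atTop.atTop_mul_const hQ)
      have t2 : Tendsto (fun _ : ℕ => x 0) atTop (𝓝 0) := by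
        refine t1.congr fun n => ?_
        simpa using hper.nat_mul n 0
      exact hx0 (tendsto_nhds_unique tendsto_const_nhds t2)
    · intro hs
      have t1 := (hs x hx hxC).comp
        (tendsto_neg_atTop_atBot.comp (tendsto_natCast_atTop_atTop.atTop_mul_const hQ))
      have t2 : Tendsto (fun _ : ℕ => x 0) atTop (𝓝 0) := by
        refine t1.congr fun n => ?_
        simpa using hper.sub_nat_mul_eq n (x := 0)
      exact hx0 (tendsto_nhds_unique tendsto_const_nhds t2)
  refine ⟨⟨fun hc => ?_, c1⟩, ⟨fun hs => ?_, c2⟩, ⟨fun hs => ?_, c3⟩⟩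
  · rcases lt_trichotomy σ 0 with h | h | h
    · exact absurd (c2 h) (s3 hc).1
    · exact h
    · exact absurd (c3 h) (s3 hc).2
  · exact not_le.1 fun h => s1 h hs
  · exact not_le.1 fun h => s2 h hs

/-! ### Return maps for γ = 0 -/

/-- The solution with `λ² x₁ - λ x₂ + x₃ = c e^{λt}` of the linear system with eigenvalues `λ = l`
and `l ± b i` that starts at `(0, -v, c - l v)`. -/
noncomputable def centerSolution (l b v c t : ℝ) : Fin 3 → ℝ :=
  Real.exp (l * t) • ![c / b ^ 2 * (1 - Real.cos (b * t)) + v / b * Real.sin (b * t),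
    2 * l * (c / b ^ 2 * (1 - Real.cos (b * t)) + v / b * Real.sin (b * t))
      - (c / b * Real.sin (b * t) + v * Real.cos (b * t)),
    c + l ^ 2 * (c / b ^ 2 * (1 - Real.cos (b * t)) + v / b * Real.sin (b * t))
      - l * (c / b * Real.sin (b * t) + v * Real.cos (b * t))]

theorem hasDerivAt_centerSolution {l b : ℝ} (hb : 0 < b) (v c t : ℝ) :
    HasDerivAt (centerSolution l b v c)
      ((obsMatrix (3 * l) (3 * l ^ 2 + b ^ 2) (l * (l ^ 2 + b ^ 2))).mulVec
        (centerSolution l b v c t)) t := by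
  have hlin : ∀ k : ℝ, HasDerivAt (fun t => k * t) k t := fun k => by
    simpa using (hasDerivAt_id t).const_mul k
  have he := (hlin l).exp
  have hu : HasDerivAt (fun t => c / b ^ 2 * (1 - Real.cos (b * t)) + v / b * Real.sin (b * t))
      (c / b * Real.sin (b * t) + v * Real.cos (b * t)) t := by
    refine ((((hlin b).cos.const_sub 1).const_mul (c / b ^ 2)).add
      ((hlin b).sin.const_mul (v / b))).congr_deriv ?_
    field_simp
  have hw : HasDerivAt (fun t => c / b * Real.sin (b * t) + v * Real.cos (b * t))
      (c - b ^ 2 * (c / b ^ 2 * (1 - Real.cos (b * t)) + v / b * Real.sin (b * t))) t := by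
    refine (((hlin b).sin.const_mul (c / b)).add ((hlin b).cos.const_mul v)).congr_deriv ?_
    field_simp
    ring
  rw [hasDerivAt_pi, obsMatrix_mulVec]
  intro i
  fin_cases i
  · simp only [centerSolution, Pi.smul_apply, smul_eq_mul, Fin.zero_eta, Matrix.cons_val_zero,
      Matrix.cons_val_one]
    refine (he.mul hu).congr_deriv ?_
    ring
  · simp only [centerSolution, Pi.smul_apply, smul_eq_mul, Fin.mk_one, Matrix.cons_val_zero,
      Matrix.cons_val_one, Matrix.cons_val]
    refine (he.mul ((hu.const_mul (2 * l)).sub hw)).congr_deriv ?_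
    simp only [Pi.sub_apply]
    ring
  · simp only [centerSolution, Pi.smul_apply, smul_eq_mul, Fin.reduceFinMk, Matrix.cons_val_zero,
      Matrix.cons_val_one, Matrix.cons_val]
    refine (he.mul (((hu.const_mul (l ^ 2)).const_add c).sub (hw.const_mul l))).congr_deriv ?_
    simp only [Pi.sub_apply]
    ring

section
variable {lp bp lm bm δm mm dm : ℝ} {x : ℝ → Fin 3 → ℝ}

theorem centerSolution_zero (l b : ℝ) {p : Fin 3 → ℝ} (hp : p 0 = 0) :
    centerSolution l b (-p 1) (p 2 - l * p 1) 0 = p := by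
  ext i
  fin_cases i <;> simp [centerSolution, hp]

/-- The half-return map of the zone `x₁ ≥ 0`. -/
theorem IsPWLSolution.half_return (hb : 0 < bp)
    (hx : IsPWLSolution (obsMatrix (3 * lp) (3 * lp ^ 2 + bp ^ 2) (lp * (lp ^ 2 + bp ^ 2)))
      (obsMatrix δm mm dm) x) {a : ℝ} (h0 : x a 0 = 0) (h1 : x a 1 < 0) :
    ∃ c, a < c ∧ x c 0 = 0 ∧ x c 1 = -(Real.exp (lp * (c - a)) * x a 1) ∧
      x c 2 = Real.exp (lp * (c - a)) * (x a 2 - 2 * lp * x a 1) := by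
  set v := -x a 1 with hv
  set k := x a 2 - lp * x a 1 with hk
  have hvpos : 0 < v := by linarith
  -- Amplitude and phase are chosen so that e^{-λt}x₁ = (2R/b²) sin(bt/2) sin(θ - bt/2). This is
  -- nonnegative up to bt = 2θ and vanishes there, which gives the return time 2θ/b.
  set R := Real.sqrt (k ^ 2 + (v * bp) ^ 2) with hR
  have hRR : R ^ 2 = k ^ 2 + (v * bp) ^ 2 := Real.sq_sqrt (by positivity)
  have hRpos : 0 < R := Real.sqrt_pos.2 (by positivity)
  have hlt : (-k / R) ^ 2 < 1 := by
    rw [div_pow, div_lt_one (by positivity), hRR, neg_sq]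
    have : 0 < (v * bp) ^ 2 := by positivity
    linarith
  have habs := abs_lt.1 ((sq_lt_one_iff_abs_lt_one _).1 hlt)
  set θ := Real.arccos (-k / R) with hθ
  have hcos : Real.cos θ = -k / R := Real.cos_arccos habs.1.le habs.2.le
  have hsin : Real.sin θ = v * bp / R := by
    rw [Real.sin_arccos, Real.sqrt_eq_iff_mul_self_eq_of_pos (by positivity)]
    field_simp
    linarith
  have hθpos : 0 < θ := Real.arccos_pos.2 habs.2
  have hθpi : θ ≤ Real.pi := Real.arccos_le_pi _
  have hbal : k * Real.sin θ + v * bp * Real.cos θ = 0 := by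
    rw [hsin, hcos]; ring
  have hsol := hx.eqOn_of_linear (z := centerSolution lp bp v k) (a := a) (c := 2 * θ / bp)
    (hasDerivAt_centerSolution hb v k) (centerSolution_zero lp bp h0).symm ?_
  · have hc : 0 < 2 * θ / bp := by positivity
    have hend := hsol (2 * θ / bp) ⟨hc.le, le_rfl⟩
    have harg : bp * (2 * θ / bp) = 2 * θ := by field_simp
    have hu : k / bp ^ 2 * (1 - Real.cos (2 * θ)) + v / bp * Real.sin (2 * θ) = 0 := by
      rw [Real.cos_two_mul, Real.sin_two_mul]
      field_simp
      linear_combination 2 * Real.sin θ * hbal - 2 * k * Real.sin_sq_add_cos_sq θ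
    have hw : k / bp * Real.sin (2 * θ) + v * Real.cos (2 * θ) = -v := by
      rw [Real.cos_two_mul, Real.sin_two_mul]
      field_simp
      linear_combination 2 * Real.cos θ * hbal
    refine ⟨2 * θ / bp + a, by linarith, ?_, ?_, ?_⟩
    · rw [hend]
      simp [centerSolution, harg, hu]
    · rw [hend, add_sub_cancel_right]
      simp only [centerSolution, Pi.smul_apply, smul_eq_mul, Matrix.cons_val_zero,
        Matrix.cons_val_one, harg, hu, hw]
      rw [hv]
      ring
    · rw [hend, add_sub_cancel_right]
      simp [centerSolution, harg, hu, hw]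
      rw [hk, hv]
      ring
  · intro t ht
    have hs : bp * t = 2 * (bp * t / 2) := by ring
    have h2 : k * Real.sin (bp * t / 2) + v * bp * Real.cos (bp * t / 2)
        = R * Real.sin (θ - bp * t / 2) := by
      rw [Real.sin_sub, hsin, hcos]
      field_simp
      ring
    have hle : bp * t / 2 ≤ θ := by
      have := (le_div_iff₀ hb).1 ht.2
      linarith
    have ht0 : 0 ≤ bp * t / 2 := by have := ht.1; positivity
    have h3 : 0 ≤ Real.sin (bp * t / 2) :=
      Real.sin_nonneg_of_nonneg_of_le_pi ht0 (hle.trans hθpi)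
    have h4 : 0 ≤ Real.sin (θ - bp * t / 2) :=
      Real.sin_nonneg_of_nonneg_of_le_pi (by linarith) (by linarith)
    have h5 : k / bp ^ 2 * (1 - Real.cos (bp * t)) + v / bp * Real.sin (bp * t)
        = 2 / bp ^ 2 * Real.sin (bp * t / 2) * (R * Real.sin (θ - bp * t / 2)) := by
      rw [← h2, hs, Real.cos_two_mul, Real.sin_two_mul, ← hs]
      field_simp
      linear_combination -2 * k * Real.sin_sq_add_cos_sq (bp * t / 2)
    simp only [centerSolution, Pi.smul_apply, smul_eq_mul, Matrix.cons_val_zero]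
    rw [h5]
    positivity

/-- The half-return map of the zone `x₁ ≤ 0`. -/
theorem IsPWLSolution.half_return' {δp mp dp : ℝ} (hb : 0 < bm)
    (hx : IsPWLSolution (obsMatrix δp mp dp)
      (obsMatrix (3 * lm) (3 * lm ^ 2 + bm ^ 2) (lm * (lm ^ 2 + bm ^ 2))) x)
    {a : ℝ} (h0 : x a 0 = 0) (h1 : 0 < x a 1) :
    ∃ c, a < c ∧ x c 0 = 0 ∧ x c 1 = -(Real.exp (lm * (c - a)) * x a 1) ∧
      x c 2 = Real.exp (lm * (c - a)) * (x a 2 - 2 * lm * x a 1) := by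
  obtain ⟨c, hc, e0, e1, e2⟩ := hx.neg.half_return hb (a := a) (by simpa using h0)
    (by simpa using h1)
  simp only [Pi.neg_apply] at e0 e1 e2
  exact ⟨c, hc, by linarith, by linarith, by linarith⟩

/-- The two sign changes of x₂ cancel and the growth factors multiply; only for equal λ do they
combine into an exponential of the total time. -/
theorem IsPWLSolution.full_return (hbp : 0 < bp) (hbm : 0 < bm)
    (hx : IsPWLSolution (obsMatrix (3 * lp) (3 * lp ^ 2 + bp ^ 2) (lp * (lp ^ 2 + bp ^ 2)))
      (obsMatrix (3 * lm) (3 * lm ^ 2 + bm ^ 2) (lm * (lm ^ 2 + bm ^ 2))) x)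
    {a : ℝ} (h0 : x a 0 = 0) (h1 : x a 1 < 0) :
    ∃ c, a < c ∧ ∃ E, 0 < E ∧ x c 0 = 0 ∧ x c 1 = E * x a 1 ∧
      x c 2 = E * (x a 2 + 2 * (lm - lp) * x a 1) ∧ (lp = lm → E = Real.exp (lm * (c - a))) := by
  obtain ⟨c, hc, e0, e1, e2⟩ := hx.half_return hbp h0 h1
  obtain ⟨d, hd, f0, f1, f2⟩ := hx.half_return' hbm e0
    (by rw [e1, neg_pos]; exact mul_neg_of_pos_of_neg (Real.exp_pos _) h1)
  refine ⟨d, hc.trans hd, Real.exp (lm * (d - c)) * Real.exp (lp * (c - a)), by positivity, f0,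
    ?_, ?_, ?_⟩
  · rw [f1, e1]; ring
  · rw [f2, e1, e2]; ring
  · rintro rfl
    rw [← Real.exp_add]
    congr 1
    ring

/-- Since x₂ = 0 means zero velocity of x₁ on the plane, e^{-λt}x₁ becomes a nonnegative multiple of
1 - cos, and the orbit stays in the closed zone for all time. -/
theorem IsPWLSolution.nonneg_of_tangent (hb : 0 < bp)
    (hx : IsPWLSolution (obsMatrix (3 * lp) (3 * lp ^ 2 + bp ^ 2) (lp * (lp ^ 2 + bp ^ 2)))
      (obsMatrix δm mm dm) x) {a : ℝ} (h0 : x a 0 = 0) (h1 : x a 1 = 0) (h2 : 0 ≤ x a 2) (t : ℝ) :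
    0 ≤ x t 0 := by
  have hpos : ∀ t, 0 ≤ centerSolution lp bp 0 (x a 2) t 0 := by
    intro t
    have := Real.cos_le_one (bp * t)
    simp only [centerSolution, Pi.smul_apply, smul_eq_mul, Matrix.cons_val_zero, zero_div,
      zero_mul, add_zero]
    have : 0 ≤ 1 - Real.cos (bp * t) := by linarith
    positivity
  have hz : IsPWLSolution (obsMatrix (3 * lp) (3 * lp ^ 2 + bp ^ 2) (lp * (lp ^ 2 + bp ^ 2)))
      (obsMatrix δm mm dm) (centerSolution lp bp 0 (x a 2)) := by
    intro t
    rw [pwlField, if_pos (hpos t)]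
    exact hasDerivAt_centerSolution hb _ _ t
  have := (hx.comp_add a).unique hz (a := 0) (by
    have := centerSolution_zero lp bp h0
    simp only [h1, neg_zero, mul_zero, sub_zero] at this
    simpa using this.symm)
  have h := hpos (t - a)
  rw [← this] at h
  simpa using h

/-- A tangency would confine the orbit to one closed zone, so a two-zonal orbit crosses
transversally and x₃/x₂ is defined at each crossing. -/
theorem IsPWLSolution.ne_zero_of_two_zonal (hbp : 0 < bp) (hbm : 0 < bm)
    (hx : IsPWLSolution (obsMatrix (3 * lp) (3 * lp ^ 2 + bp ^ 2) (lp * (lp ^ 2 + bp ^ 2)))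
      (obsMatrix (3 * lm) (3 * lm ^ 2 + bm ^ 2) (lm * (lm ^ 2 + bm ^ 2))) x)
    (hneg : ∃ t, x t 0 < 0) (hpos : ∃ t, 0 < x t 0) {a : ℝ} (h0 : x a 0 = 0) : x a 1 ≠ 0 := by
  intro h1
  obtain ⟨s, hs⟩ := hneg
  obtain ⟨t, ht⟩ := hpos
  rcases le_total 0 (x a 2) with h2 | h2
  · exact hs.not_ge (hx.nonneg_of_tangent hbp h0 h1 h2 s)
  · have := hx.neg.nonneg_of_tangent hbm (a := a) (by simpa using h0) (by simpa using h1)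
      (by simpa using h2) t
    simp only [Pi.neg_apply] at this
    linarith

theorem IsPWLSolution.exists_crossing (hbp : 0 < bp) (hbm : 0 < bm)
    (hx : IsPWLSolution (obsMatrix (3 * lp) (3 * lp ^ 2 + bp ^ 2) (lp * (lp ^ 2 + bp ^ 2)))
      (obsMatrix (3 * lm) (3 * lm ^ 2 + bm ^ 2) (lm * (lm ^ 2 + bm ^ 2))) x)
    {s t c : ℝ} (hs : c ≤ s) (ht : c ≤ t) (hneg : x s 0 < 0) (hpos : 0 < x t 0) :
    ∃ a, c ≤ a ∧ x a 0 = 0 ∧ x a 1 < 0 := by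
  have hcont : Continuous (fun t => x t 0) := (continuous_apply 0).comp hx.continuous
  obtain ⟨a, ha, ha0⟩ : (0 : ℝ) ∈ (fun t => x t 0) '' uIcc s t :=
    intermediate_value_uIcc hcont.continuousOn (by
      rw [uIcc_of_le (by linarith)]; exact ⟨hneg.le, hpos.le⟩)
  have hca : c ≤ a := (le_inf hs ht).trans ha.1
  rcases (hx.ne_zero_of_two_zonal hbp hbm ⟨s, hneg⟩ ⟨t, hpos⟩ ha0).lt_or_gt with h | h
  · exact ⟨a, hca, ha0, h⟩
  · obtain ⟨d, hd, f0, f1, -⟩ := hx.half_return' hbm ha0 h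
    exact ⟨d, hca.trans hd.le, f0, by rw [f1, neg_lt_zero]; positivity⟩

/-- If the solution is self-similar, then the ratio `x₃ / x₂` at upward crossings takes values in a
compact set, while the full return shifts it by `2 (λ⁻ - λ⁺)`. -/
theorem IsPWLSolution.eigenvalues_eq (hbp : 0 < bp) (hbm : 0 < bm)
    (hx : IsPWLSolution (obsMatrix (3 * lp) (3 * lp ^ 2 + bp ^ 2) (lp * (lp ^ 2 + bp ^ 2)))
      (obsMatrix (3 * lm) (3 * lm ^ 2 + bm ^ 2) (lm * (lm ^ 2 + bm ^ 2))) x)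
    {T ρ : ℝ} (hT : 0 < T) (hρ : 0 < ρ) (hxT : ∀ t, x (t + T) = ρ • x t)
    (hneg : ∃ t, 0 ≤ t ∧ x t 0 < 0) (hpos : ∃ t, 0 ≤ t ∧ 0 < x t 0) : lp = lm := by
  have hne : ∀ a, x a 0 = 0 → x a 1 ≠ 0 := fun a h =>
    hx.ne_zero_of_two_zonal hbp hbm (hneg.imp fun _ h => h.2) (hpos.imp fun _ h => h.2) h
  have hcont : ∀ i, Continuous (fun t => x t i) := fun i => (continuous_apply i).comp hx.continuous
  have hcomp : IsCompact (Icc 0 T ∩ {t | x t 0 = 0}) :=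
    isCompact_Icc.inter_right (isClosed_eq (hcont 0) continuous_const)
  obtain ⟨M, hM⟩ := hcomp.exists_bound_of_continuousOn (f := fun t => x t 2 / x t 1)
    ((hcont 2).continuousOn.div (hcont 1).continuousOn fun t ht => hne t ht.2)
  have hpow : ∀ n : ℕ, ∀ t, x (t + n * T) = ρ ^ n • x t := by
    intro n t
    induction n with
    | zero => simp
    | succ n ih =>
      rw [show t + (n + 1 : ℕ) * T = t + n * T + T by push_cast; ring, hxT, ih, smul_smul, pow_succ']
  -- The ratio is invariant under scaling, so self-similarity moves any later crossing back into [0,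
  -- T], where compactness gives the bound M.
  have hbound : ∀ a, 0 ≤ a → x a 0 = 0 → |x a 2 / x a 1| ≤ M := by
    intro a ha h0
    set n := ⌊a / T⌋₊
    have h1 : (n : ℝ) * T ≤ a := (le_div_iff₀ hT).1 (Nat.floor_le (by positivity))
    have h2 : a < (n + 1) * T := (div_lt_iff₀ hT).1 (Nat.lt_floor_add_one _)
    have h3 := hpow n (a - n * T)
    rw [sub_add_cancel] at h3
    have hρn : 0 < ρ ^ n := pow_pos hρ n
    rw [h3] at h0 ⊢
    simp only [Pi.smul_apply, smul_eq_mul] at h0 ⊢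
    rw [mul_div_mul_left _ _ hρn.ne']
    exact hM _ ⟨⟨by linarith, by linarith⟩, (mul_eq_zero.1 h0).resolve_left hρn.ne'⟩
  obtain ⟨s, hs, hs0⟩ := hneg
  obtain ⟨t, ht, ht0⟩ := hpos
  obtain ⟨a, ha, ha0, ha1⟩ := hx.exists_crossing hbp hbm hs ht hs0 ht0
  have hiter : ∀ n : ℕ, ∃ c, 0 ≤ c ∧ x c 0 = 0 ∧ x c 1 < 0 ∧
      x c 2 / x c 1 = x a 2 / x a 1 + n * (2 * (lm - lp)) := by
    intro n
    induction n with
    | zero => exact ⟨a, ha, ha0, ha1, by simp⟩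
    | succ n ih =>
      obtain ⟨c, hc, hc0, hc1, hc2⟩ := ih
      obtain ⟨d, hd, E, hE, hd0, hd1, hd2, -⟩ := hx.full_return hbp hbm hc0 hc1
      refine ⟨d, hc.trans hd.le, hd0, by rw [hd1]; exact mul_neg_of_pos_of_neg hE hc1, ?_⟩
      rw [hd1, hd2, mul_div_mul_left _ _ hE.ne', add_div, hc2, mul_div_assoc, div_self hc1.ne]
      push_cast
      ring
  by_contra hcontra
  have hD : 0 < |2 * (lm - lp)| := abs_pos.2 (by
    intro h
    exact hcontra (by linarith))
  -- Two ratios bounded by M differ by at most 2M, and n returns shift the ratio by more than that.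
  obtain ⟨n, hn⟩ := exists_nat_gt (2 * M / |2 * (lm - lp)|)
  obtain ⟨c, hc, hc0, hc1, hc2⟩ := hiter n
  have b1 := hbound c hc hc0
  have b2 := hbound a ha ha0
  rw [div_lt_iff₀ hD] at hn
  have h4 : (n : ℝ) * |2 * (lm - lp)| = |x c 2 / x c 1 - x a 2 / x a 1| := by
    rw [hc2, add_sub_cancel_left, abs_mul (n : ℝ), Nat.abs_cast]
  have h5 := abs_sub (x c 2 / x c 1) (x a 2 / x a 1)
  linarith

theorem IsPWLSolution.self_similar (hbp : 0 < bp) (hbm : 0 < bm)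
    (hx : IsPWLSolution (obsMatrix (3 * lm) (3 * lm ^ 2 + bp ^ 2) (lm * (lm ^ 2 + bp ^ 2)))
      (obsMatrix (3 * lm) (3 * lm ^ 2 + bm ^ 2) (lm * (lm ^ 2 + bm ^ 2))) x)
    (hneg : ∃ t, x t 0 < 0) (hpos : ∃ t, 0 < x t 0) :
    ∃ P, 0 < P ∧ ∀ t, x (t + P) = Real.exp (lm * P) • x t := by
  obtain ⟨s, hs0⟩ := hneg
  obtain ⟨t, ht0⟩ := hpos
  obtain ⟨a, -, ha0, ha1⟩ := hx.exists_crossing hbp hbm (min_le_left s t) (min_le_right s t) hs0 ht0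
  obtain ⟨c, hc, E, hE, hc0, hc1, hc2, hEE⟩ := hx.full_return hbp hbm ha0 ha1
  refine ⟨c - a, by linarith, fun t => ?_⟩
  rw [← hEE rfl]
  have := (hx.comp_add (c - a)).eq_smul_shift hx hE (a := a) (s := 0) ?_ t
  · simpa using this
  · simp only [add_sub_cancel, add_zero]
    ext i
    fin_cases i
    · simp [hc0, ha0]
    · simp [hc1]
    · simp [hc2]

end

/-! ### Reduction of a cone to a single orbit -/

/-- By homogeneity and uniqueness all orbits on the cone are rescaled time shifts of the one through
v, and its return to the half-line makes that orbit self-similar. -/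
theorem IsTwoZonalInvariantCone.exists_orbit {δp mp dp δm mm dm : ℝ} {C : Set (Fin 3 → ℝ)}
    (hC : IsTwoZonalInvariantCone (obsMatrix δp mp dp) (obsMatrix δm mm dm) C) :
    ∃ x, IsPWLSolution (obsMatrix δp mp dp) (obsMatrix δm mm dm) x ∧ x 0 ∈ C ∧ x 0 ≠ 0 ∧
      (∃ T : ℝ, 0 < T ∧ ∃ ρ : ℝ, 0 < ρ ∧ ∀ t, x (t + T) = ρ • x t) ∧
      (∃ t, 0 ≤ t ∧ x t 0 < 0) ∧ (∃ t, 0 ≤ t ∧ 0 < x t 0) ∧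
      ∀ y, IsPWLSolution (obsMatrix δp mp dp) (obsMatrix δm mm dm) y → y 0 ∈ C →
        ∃ s r : ℝ, 0 < r ∧ ∀ t, y t = r • x (t + s) := by
  obtain ⟨⟨v, hv, T, hT, hl, rfl⟩, ⟨p, ⟨y, hy, hy0, t, ht, rfl⟩, hp⟩,
    ⟨q, ⟨z, hz, hz0, u, hu, rfl⟩, hq⟩⟩ := hC
  have hvl : v ∈ halfLine v := ⟨1, one_pos, (one_smul _ _).symm⟩
  obtain ⟨x, hx, hx0, ⟨ρ, hρ, hxT⟩, -⟩ := hl v hvl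
  have hscale : ∀ y, IsPWLSolution (obsMatrix δp mp dp) (obsMatrix δm mm dm) y →
      y 0 ∈ halfLine v → ∃ r : ℝ, 0 < r ∧ ∀ t, y t = r • x t := by
    rintro y hy ⟨r, hr, hyr⟩
    refine ⟨r, hr, fun t => ?_⟩
    simpa using hy.eq_smul_shift hx hr (a := 0) (s := 0) (by simpa [hx0] using hyr) t
  refine ⟨x, hx, ⟨x, hx, by rwa [hx0], 0, ⟨le_rfl, hT.le⟩, rfl⟩, by rwa [hx0], ⟨T, hT, ρ, hρ, ?_⟩,
    ⟨u, hu.1, ?_⟩, ⟨t, ht.1, ?_⟩, ?_⟩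
  · intro t
    simpa using (hx.comp_add T).eq_smul_shift hx hρ (a := 0) (s := 0) (by simpa [hx0] using hxT) t
  · obtain ⟨r, hr, h⟩ := hscale z hz hz0
    rw [h, Pi.smul_apply, smul_eq_mul] at hq
    exact (pos_iff_neg_of_mul_neg hq).1 hr
  · obtain ⟨r, hr, h⟩ := hscale y hy hy0
    rw [h, Pi.smul_apply, smul_eq_mul] at hp
    exact (pos_iff_pos_of_mul_pos hp).1 hr
  · rintro w hw ⟨y', hy', hy0', s, -, hs⟩
    obtain ⟨r, hr, h⟩ := hscale y' hy' hy0'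
    refine ⟨s, r, hr, fun t => hw.eq_smul_shift hx hr (a := 0) ?_ t⟩
    rw [← hs, h, zero_add]

theorem cone_dynamics_of_gamma_zero {lp bp lm bm : ℝ} (hbp : 0 < bp) (hbm : 0 < bm)
    {C : Set (Fin 3 → ℝ)} {Ap Am : Matrix (Fin 3) (Fin 3) ℝ}
    (hAp : Ap = obsMatrix (3 * lp) (3 * lp ^ 2 + bp ^ 2) (lp * (lp ^ 2 + bp ^ 2)))
    (hAm : Am = obsMatrix (3 * lm) (3 * lm ^ 2 + bm ^ 2) (lm * (lm ^ 2 + bm ^ 2)))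
    (hC : IsTwoZonalInvariantCone Ap Am C) :
    lp = lm ∧ (IsCenterOn Ap Am C ↔ lm = 0) ∧ (IsStableFocusOn Ap Am C ↔ lm < 0) ∧
      (IsUnstableFocusOn Ap Am C ↔ 0 < lm) := by
  subst hAp hAm
  obtain ⟨x, hx, hxC, hx0, ⟨T, hT, ρ, hρ, hxT⟩, hneg, hpos, hall⟩ := hC.exists_orbit
  have hl := hx.eigenvalues_eq hbp hbm hT hρ hxT hneg hpos
  refine ⟨hl, ?_⟩
  subst hl
  refine focus_type_of_self_similar ⟨x, hx, hxC, hx0⟩ fun y hy hyC => ?_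
  obtain ⟨s, r, hr, hys⟩ := hall y hy hyC
  obtain ⟨P, hP, h⟩ := hx.self_similar hbp hbm (hneg.imp fun _ h => h.2) (hpos.imp fun _ h => h.2)
  refine ⟨P, hP, fun t => ?_⟩
  rw [hys, hys, add_right_comm, h, smul_comm]

/-! ### The focus plane and the linear flow on it -/

/-- The matrix (A - a)² + b² has rank one: it is the right eigenvector (1, 2a, a² + b²) for l times
the left eigenvector (l², -l, 1). So the plane depends on l alone. -/
theorem mem_focusPlane {l a b : ℝ} {x : Fin 3 → ℝ} :
    x ∈ focusPlane (obsMatrix (l + 2 * a) (2 * l * a + (a ^ 2 + b ^ 2)) (l * (a ^ 2 + b ^ 2))) a b ↔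
      l ^ 2 * x 0 - l * x 1 + x 2 = 0 := by
  have h : ((obsMatrix (l + 2 * a) (2 * l * a + (a ^ 2 + b ^ 2)) (l * (a ^ 2 + b ^ 2))
        - a • (1 : Matrix (Fin 3) (Fin 3) ℝ)) ^ 2 + b ^ 2 • (1 : Matrix (Fin 3) (Fin 3) ℝ)).mulVec x
      = (l ^ 2 * x 0 - l * x 1 + x 2) • ![1, 2 * a, a ^ 2 + b ^ 2] := by
    ext i
    fin_cases i <;>
      simp [obsMatrix, pow_two, Matrix.mulVec, dotProduct, Matrix.mul_apply, Fin.sum_univ_three,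
        Matrix.one_apply] <;> ring
  rw [focusPlane, LinearMap.mem_ker, Matrix.mulVecLin_apply, h, smul_eq_zero]
  refine or_iff_left fun h => ?_
  simpa using congrFun h 0

/-- The solution in the focus plane of the linear system with eigenvalues `l` and `a ± b i` that
starts at `(0, -1, -l)`. -/
noncomputable def planeSolution (l a b t : ℝ) : Fin 3 → ℝ :=
  Real.exp (a * t) • ![Real.sin (b * t) / b,
    (l + a) * (Real.sin (b * t) / b) - Real.cos (b * t),
    l * (a * (Real.sin (b * t) / b) - Real.cos (b * t))]

theorem hasDerivAt_planeSolution {b : ℝ} (hb : 0 < b) (l a t : ℝ) :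
    HasDerivAt (planeSolution l a b)
      ((obsMatrix (l + 2 * a) (2 * l * a + (a ^ 2 + b ^ 2)) (l * (a ^ 2 + b ^ 2))).mulVec
        (planeSolution l a b t)) t := by
  have hlin : ∀ k : ℝ, HasDerivAt (fun t => k * t) k t := fun k => by
    simpa using (hasDerivAt_id t).const_mul k
  have he := (hlin a).exp
  have hs := (hlin b).sin.div_const b
  have hc := (hlin b).cos
  rw [hasDerivAt_pi, obsMatrix_mulVec]
  intro i
  fin_cases i
  · simp only [planeSolution, Pi.smul_apply, smul_eq_mul, Fin.zero_eta, Matrix.cons_val_zero,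
      Matrix.cons_val_one]
    refine (he.mul hs).congr_deriv ?_
    field_simp
    ring
  · simp only [planeSolution, Pi.smul_apply, smul_eq_mul, Fin.mk_one, Matrix.cons_val_zero,
      Matrix.cons_val_one, Matrix.cons_val]
    refine (he.mul ((hs.const_mul (l + a)).sub hc)).congr_deriv ?_
    simp only [Pi.sub_apply]
    field_simp
    ring
  · simp only [planeSolution, Pi.smul_apply, smul_eq_mul, Fin.reduceFinMk, Matrix.cons_val_zero,
      Matrix.cons_val_one, Matrix.cons_val]
    refine (he.mul (((hs.const_mul a).sub hc).const_mul l)).congr_deriv ?_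
    simp only [Pi.sub_apply]
    field_simp
    ring

theorem planeSolution_zero (l a b : ℝ) : planeSolution l a b 0 = ![0, -1, -l] := by
  simp [planeSolution]

theorem planeSolution_half_turn {b : ℝ} (hb : 0 < b) (l a : ℝ) :
    planeSolution l a b (Real.pi / b) = -(Real.exp (a * (Real.pi / b)) • ![0, -1, -l]) := by
  have : b * (Real.pi / b) = Real.pi := by field_simp
  simp [planeSolution, this]

theorem planeSolution_mem (l a b t : ℝ) :
    l ^ 2 * planeSolution l a b t 0 - l * planeSolution l a b t 1 + planeSolution l a b t 2 = 0 := by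
  simp [planeSolution]
  ring

theorem planeSolution_pos {b : ℝ} (hb : 0 < b) (l a : ℝ) {t : ℝ} (ht : t ∈ Ioo 0 (Real.pi / b)) :
    0 < planeSolution l a b t 0 := by
  have h1 : 0 < b * t := mul_pos hb ht.1
  have h2 : b * t < Real.pi := by
    have := (lt_div_iff₀ hb).1 ht.2
    linarith
  have := Real.sin_pos_of_pos_of_lt_pi h1 h2
  simp only [planeSolution, Pi.smul_apply, smul_eq_mul, Matrix.cons_val_zero]
  positivity

theorem planeSolution_nonneg {b : ℝ} (hb : 0 < b) (l a : ℝ) {t : ℝ}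
    (ht : t ∈ Icc 0 (Real.pi / b)) : 0 ≤ planeSolution l a b t 0 := by
  rcases eq_endpoints_or_mem_Ioo_of_mem_Icc ht with rfl | rfl | h
  · simp [planeSolution_zero]
  · simp [planeSolution_half_turn hb]
  · exact (planeSolution_pos hb l a h).le

theorem exists_planeSolution_eq {b : ℝ} (hb : 0 < b) (l a : ℝ) {q : Fin 3 → ℝ} (hq0 : 0 < q 0)
    (hq : l ^ 2 * q 0 - l * q 1 + q 2 = 0) :
    ∃ t ∈ Ioo 0 (Real.pi / b), ∃ r : ℝ, 0 < r ∧ q = r • planeSolution l a b t := by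
  -- Polar coordinates in the plane: along `planeSolution` the pair (b x₁, (l + a)x₁ - x₂) equals
  -- e^{at}(sin bt, cos bt).
  set w := (l + a) * q 0 - q 1 with hw
  set R := Real.sqrt ((b * q 0) ^ 2 + w ^ 2) with hR
  have hRR : R ^ 2 = (b * q 0) ^ 2 + w ^ 2 := Real.sq_sqrt (by positivity)
  have hRpos : 0 < R := Real.sqrt_pos.2 (by positivity)
  have hlt : (w / R) ^ 2 < 1 := by
    rw [div_pow, div_lt_one (by positivity), hRR]
    have : 0 < (b * q 0) ^ 2 := by positivity
    linarith
  have habs := abs_lt.1 ((sq_lt_one_iff_abs_lt_one _).1 hlt)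
  set θ := Real.arccos (w / R) with hθ
  have hcos : Real.cos θ = w / R := Real.cos_arccos habs.1.le habs.2.le
  have hsin : Real.sin θ = b * q 0 / R := by
    rw [Real.sin_arccos, Real.sqrt_eq_iff_mul_self_eq_of_pos (by positivity)]
    field_simp
    linarith
  have hθpos : 0 < θ := Real.arccos_pos.2 habs.2
  have hθpi : θ < Real.pi := (Real.arccos_le_pi _).lt_of_ne fun h => by
    have : 0 < Real.sin θ := by rw [hsin]; positivity
    rw [hθ, h, Real.sin_pi] at this
    exact this.false
  have harg : b * (θ / b) = θ := by field_simp
  refine ⟨θ / b, ⟨by positivity, by gcongr⟩, R * Real.exp (-(a * (θ / b))), by positivity, ?_⟩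
  rw [planeSolution, smul_smul, mul_assoc, ← Real.exp_add, neg_add_cancel, Real.exp_zero, mul_one,
    harg, hsin, hcos]
  have e0 : R * (b * q 0 / R / b) = q 0 := by field_simp
  have e1 : R * (w / R) = w := by field_simp
  ext i
  fin_cases i
  · simp only [Fin.zero_eta, Pi.smul_apply, smul_eq_mul, Matrix.cons_val_zero]
    exact e0.symm
  · simp only [Fin.mk_one, Pi.smul_apply, smul_eq_mul, Matrix.cons_val_one, Matrix.cons_val_zero]
    linear_combination -(l + a) * e0 + e1 + hw
  · simp only [Fin.reduceFinMk, Pi.smul_apply, smul_eq_mul, Matrix.cons_val]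
    linear_combination hq - l * a * e0 + l * e1 + l * hw

/-! ### Gluing and extending solution segments -/

section
variable {E : Type*} [NormedAddCommGroup E] [NormedSpace ℝ E]

/-- The one-sided derivatives at the joint are both F of the common value, so no smoothness of F is
needed. -/
theorem hasDerivAt_ite_of_eq {f g : ℝ → E} {F : E → E} {a b c : ℝ} (hab : a ≤ b) (hbc : b ≤ c)
    (hf : ∀ t ∈ Icc a b, HasDerivAt f (F (f t)) t) (hg : ∀ t ∈ Icc b c, HasDerivAt g (F (g t)) t)
    (hfg : f b = g b) {t : ℝ} (ht : t ∈ Icc a c) :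
    HasDerivAt (fun t => if t ≤ b then f t else g t) (F (if t ≤ b then f t else g t)) t := by
  rcases lt_trichotomy t b with h | rfl | h
  · rw [if_pos h.le]
    refine (hf t ⟨ht.1, h.le⟩).congr_of_eventuallyEq ?_
    filter_upwards [Iio_mem_nhds h] with s hs
    exact if_pos (le_of_lt hs)
  · rw [if_pos le_rfl]
    have h1 : HasDerivWithinAt (fun s => if s ≤ t then f s else g s) (F (f t)) (Iic t) t :=
      (hf t ⟨hab, le_rfl⟩).hasDerivWithinAt.congr (fun s hs => if_pos hs) (if_pos le_rfl)
    have h2 : HasDerivWithinAt (fun s => if s ≤ t then f s else g s) (F (f t)) (Ici t) t := by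
      rw [hfg]
      refine (hg t ⟨le_rfl, hbc⟩).hasDerivWithinAt.congr (fun s hs => ?_) ((if_pos le_rfl).trans hfg)
      rcases eq_or_lt_of_le (mem_Ici.1 hs) with rfl | hs
      · rw [if_pos le_rfl, hfg]
      · exact if_neg hs.not_ge
    have := h1.union h2
    rwa [Iic_union_Ici, hasDerivWithinAt_univ] at this
  · rw [if_neg h.not_ge]
    refine (hg t ⟨h.le, ht.2⟩).congr_of_eventuallyEq ?_
    filter_upwards [Ioi_mem_nhds h] with s hs
    exact if_neg (not_le.2 hs)

/-- A solution segment of a positively homogeneous vector field that returns to a multiple of its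
initial value extends to a global self-similar solution. -/
theorem exists_self_similar_extension {z : ℝ → E} {F : E → E} {T ρ : ℝ} (hT : 0 < T) (hρ : 0 < ρ)
    (hF : ∀ r : ℝ, 0 < r → ∀ x, F (r • x) = r • F x)
    (hz : ∀ t ∈ Icc 0 T, HasDerivAt z (F (z t)) t) (hzT : z T = ρ • z 0) :
    ∃ x : ℝ → E, (∀ t, HasDerivAt x (F (x t)) t) ∧ (∀ t ∈ Icc 0 T, x t = z t) ∧
      ∀ t, x (t + T) = ρ • x t := by
  set x : ℝ → E := fun t => ρ ^ ⌊t / T⌋ • z (t - ⌊t / T⌋ * T) with hx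
  have hIco : ∀ (n : ℤ) t, n * T ≤ t → t < (n + 1) * T → x t = ρ ^ n • z (t - n * T) := by
    intro n t h1 h2
    have : ⌊t / T⌋ = n := Int.floor_eq_iff.2 ⟨(le_div_iff₀ hT).2 h1, (div_lt_iff₀ hT).2 h2⟩
    simp only [hx, this]
  -- The condition z T = ρ • z 0 lets the formula of the n-th piece hold at its right endpoint too,
  -- where the floor has already jumped.
  have hIcc : ∀ (n : ℤ) t, n * T ≤ t → t ≤ (n + 1) * T → x t = ρ ^ n • z (t - n * T) := by
    intro n t h1 h2
    rcases eq_or_lt_of_le h2 with rfl | h2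
    · rw [hIco (n + 1) _ (by push_cast; rfl) (by push_cast; linarith), zpow_add_one₀ hρ.ne']
      push_cast
      rw [sub_self, show ((n : ℝ) + 1) * T - n * T = T by ring, hzT, smul_smul]
    · exact hIco n t h1 h2
  have hpiece : ∀ (n : ℤ), ∀ t ∈ Icc (n * T) ((n + 1) * T),
      HasDerivAt (fun t => ρ ^ n • z (t - n * T)) (F (ρ ^ n • z (t - n * T))) t := by
    intro n t ht
    rw [hF _ (zpow_pos hρ n)]
    exact ((hz (t - n * T) ⟨by linarith [ht.1], by linarith [ht.2]⟩).comp_sub_const t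
      (n * T)).const_smul _
  refine ⟨x, fun t => ?_, fun t ht => ?_, fun t => ?_⟩
  · set n := ⌊t / T⌋ with hn
    have h1 : n * T ≤ t := (le_div_iff₀ hT).1 (Int.floor_le _)
    have h2 : t < (n + 1) * T := (div_lt_iff₀ hT).1 (Int.lt_floor_add_one _)
    have hm : ((n - 1 : ℤ) : ℝ) + 1 = n := by push_cast; ring
    have hm' : ((n - 1 : ℤ) : ℝ) * T = n * T - T := by push_cast; ring
    -- Using the pieces n - 1 and n together also covers the joint t = nT.
    have hloc : x =ᶠ[𝓝 t] fun s => if s ≤ n * T then ρ ^ (n - 1) • z (s - (n - 1 : ℤ) * T)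
        else ρ ^ n • z (s - n * T) := by
      filter_upwards [Ioo_mem_nhds (show (n - 1 : ℤ) * T < t by linarith) h2] with s hs
      split_ifs with h
      · exact hIcc (n - 1) s hs.1.le (by rwa [hm])
      · exact hIcc n s (not_le.1 h).le hs.2.le
    have := hasDerivAt_ite_of_eq (F := F) (t := t) (a := (n - 1 : ℤ) * T) (b := n * T)
      (c := (n + 1) * T) (by linarith) (by linarith) (by simpa only [hm] using hpiece (n - 1))
      (hpiece n) ?_ ⟨by linarith, h2.le⟩
    · rw [hloc.eq_of_nhds]
      exact this.congr_of_eventuallyEq hloc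
    · rw [← hIcc (n - 1) (n * T) (by linarith) (by rw [hm]), ← hIcc n (n * T) le_rfl (by linarith)]
  · simpa using hIcc 0 t (by simpa using ht.1) (by simpa using ht.2)
  · have : ⌊(t + T) / T⌋ = ⌊t / T⌋ + 1 := by
      rw [add_div, div_self hT.ne', Int.floor_add_one]
    simp only [hx, this, zpow_add_one₀ hρ.ne', smul_smul]
    push_cast
    rw [mul_comm ρ, show t + T - ((⌊t / T⌋ : ℝ) + 1) * T = t - ⌊t / T⌋ * T by ring]

end

/-! ### The trivial cone -/

section
variable {l ap bp am bm : ℝ}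

theorem exists_isPWLSolution_focusPlane (hbp : 0 < bp) (hbm : 0 < bm) :
    ∃ x, IsPWLSolution (obsMatrix (l + 2 * ap) (2 * l * ap + (ap ^ 2 + bp ^ 2)) (l * (ap ^ 2 + bp ^ 2)))
        (obsMatrix (l + 2 * am) (2 * l * am + (am ^ 2 + bm ^ 2)) (l * (am ^ 2 + bm ^ 2))) x ∧
      (∀ t ∈ Icc 0 (Real.pi / bp), x t = planeSolution l ap bp t) ∧
      (∀ t ∈ Icc (Real.pi / bp) (Real.pi / bp + Real.pi / bm), x t =
        -(Real.exp (ap * (Real.pi / bp)) • planeSolution l am bm (t - Real.pi / bp))) ∧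
      ∀ t, x (t + (Real.pi / bp + Real.pi / bm))
        = Real.exp (Real.pi * (ap / bp + am / bm)) • x t := by
  have hτp : 0 < Real.pi / bp := by positivity
  have hτm : 0 < Real.pi / bm := by positivity
  set Ap := obsMatrix (l + 2 * ap) (2 * l * ap + (ap ^ 2 + bp ^ 2)) (l * (ap ^ 2 + bp ^ 2)) with hAp
  set Am := obsMatrix (l + 2 * am) (2 * l * am + (am ^ 2 + bm ^ 2)) (l * (am ^ 2 + bm ^ 2)) with hAm
  set f := planeSolution l ap bp with hf
  set g := fun t => -(Real.exp (ap * (Real.pi / bp)) • planeSolution l am bm (t - Real.pi / bp))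
    with hg
  have hfg : f (Real.pi / bp) = g (Real.pi / bp) := by
    simp only [hf, hg, planeSolution_half_turn hbp, sub_self, planeSolution_zero]
  have hfd : ∀ t ∈ Icc 0 (Real.pi / bp), HasDerivAt f (pwlField Ap Am (f t)) t := by
    intro t ht
    rw [pwlField, if_pos (planeSolution_nonneg hbp l ap ht)]
    exact hasDerivAt_planeSolution hbp l ap t
  have hgd : ∀ t ∈ Icc (Real.pi / bp) (Real.pi / bp + Real.pi / bm),
      HasDerivAt g (pwlField Ap Am (g t)) t := by
    intro t ht
    have hmem : t - Real.pi / bp ∈ Icc 0 (Real.pi / bm) := ⟨by linarith [ht.1], by linarith [ht.2]⟩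
    simp only [hg]
    rw [pwlField_neg, pwlField_smul _ _ (Real.exp_pos _), pwlField,
      if_pos (planeSolution_nonneg hbm l am hmem)]
    exact (((hasDerivAt_planeSolution hbm l am (t - Real.pi / bp)).comp_sub_const t
      (Real.pi / bp)).const_smul (Real.exp (ap * (Real.pi / bp)))).neg
  obtain ⟨x, hx, hxz, hxT⟩ := exists_self_similar_extension
    (z := fun t => if t ≤ Real.pi / bp then f t else g t) (F := pwlField Ap Am)
    (T := Real.pi / bp + Real.pi / bm) (ρ := Real.exp (Real.pi * (ap / bp + am / bm)))
    (by positivity) (Real.exp_pos _) (fun r hr y => pwlField_smul Ap Am hr y)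
    (fun t ht => hasDerivAt_ite_of_eq hτp.le (by linarith) hfd hgd hfg ht) (by
      rw [if_neg (by linarith), if_pos hτp.le]
      simp only [hf, hg, add_sub_cancel_left, planeSolution_half_turn hbm, planeSolution_zero,
        smul_neg, neg_neg, smul_smul, ← Real.exp_add]
      congr 2
      ring)
  refine ⟨x, hx, fun t ht => ?_, fun t ht => ?_, hxT⟩
  · rw [hxz t ⟨ht.1, by linarith [ht.2]⟩, if_pos ht.2]
  · rw [hxz t ⟨by linarith [ht.1], ht.2⟩]
    rcases eq_or_lt_of_le ht.1 with rfl | h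
    · rw [if_pos le_rfl, hfg]
    · rw [if_neg h.not_ge]

/-- If the focus planes coincide, then the common focus plane without the origin is a two-zonal
invariant cone, and the solutions on it are self-similar. -/
theorem focusPlane_isTwoZonalInvariantCone (hbp : 0 < bp) (hbm : 0 < bm) {C : Set (Fin 3 → ℝ)}
    (hC : ∀ q, q ∈ C ↔ l ^ 2 * q 0 - l * q 1 + q 2 = 0 ∧ q ≠ 0)
    {Ap Am : Matrix (Fin 3) (Fin 3) ℝ}
    (hAp : Ap = obsMatrix (l + 2 * ap) (2 * l * ap + (ap ^ 2 + bp ^ 2)) (l * (ap ^ 2 + bp ^ 2)))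
    (hAm : Am = obsMatrix (l + 2 * am) (2 * l * am + (am ^ 2 + bm ^ 2)) (l * (am ^ 2 + bm ^ 2))) :
    IsTwoZonalInvariantCone Ap Am C ∧
      (IsCenterOn Ap Am C ↔ ap / bp + am / bm = 0) ∧
      (IsStableFocusOn Ap Am C ↔ ap / bp + am / bm < 0) ∧
      (IsUnstableFocusOn Ap Am C ↔ 0 < ap / bp + am / bm) := by
  obtain ⟨x, hx, hxp, hxm, hxT⟩ :=
    exists_isPWLSolution_focusPlane (l := l) (ap := ap) (am := am) hbp hbm
  rw [← hAp, ← hAm] at hx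
  have hτp : 0 < Real.pi / bp := by positivity
  have hτm : 0 < Real.pi / bm := by positivity
  set T := Real.pi / bp + Real.pi / bm with hT
  have hTpos : 0 < T := by positivity
  have hx0 : x 0 = ![0, -1, -l] := by rw [hxp 0 ⟨le_rfl, hτp.le⟩, planeSolution_zero]
  have hxne : ∀ t, x t ≠ 0 := by
    subst hAp hAm
    refine hx.ne_zero (a := 0) fun h => ?_
    simpa [hx0] using congrFun h 1
  have hpos : ∀ t ∈ Ioo 0 (Real.pi / bp), 0 < x t 0 := fun t ht => by
    rw [hxp t (Ioo_subset_Icc_self ht)]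
    exact planeSolution_pos hbp l ap ht
  have hneg : ∀ t ∈ Ioo (Real.pi / bp) T, x t 0 < 0 := fun t ht => by
    rw [hxm t (Ioo_subset_Icc_self ht)]
    have := planeSolution_pos hbm l am (t := t - Real.pi / bp)
      ⟨by linarith [ht.1], by linarith [ht.2]⟩
    simp only [Pi.neg_apply, Pi.smul_apply, smul_eq_mul, neg_lt_zero]
    positivity
  have hplane : ∀ t ∈ Icc 0 T, l ^ 2 * x t 0 - l * x t 1 + x t 2 = 0 := by
    intro t ht
    rcases le_total t (Real.pi / bp) with h | h
    · rw [hxp t ⟨ht.1, h⟩]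
      exact planeSolution_mem l ap bp t
    · rw [hxm t ⟨h, ht.2⟩]
      simp only [Pi.neg_apply, Pi.smul_apply, smul_eq_mul]
      linear_combination
        -Real.exp (ap * (Real.pi / bp)) * planeSolution_mem l am bm (t - Real.pi / bp)
  -- The two arcs sweep the open half-planes x₁ > 0 and x₁ < 0; the two rays of x₁ = 0 are reached
  -- at times 0 and π/β⁺.
  have hcover : ∀ q ∈ C, ∃ t ∈ Icc 0 T, ∃ r : ℝ, 0 < r ∧ q = r • x t := by
    intro q hq
    obtain ⟨hq, hqne⟩ := (hC q).1 hq
    have hxτ := hxp _ (right_mem_Icc.2 hτp.le)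
    rw [planeSolution_half_turn hbp] at hxτ
    rcases lt_trichotomy (q 0) 0 with h | h | h
    · obtain ⟨t, ht, r, hr, hqr⟩ := exists_planeSolution_eq hbm l am (q := -q) (by simpa using h)
        (by simp only [Pi.neg_apply]; linarith)
      refine ⟨t + Real.pi / bp, ⟨by linarith [ht.1], by linarith [ht.2]⟩,
        r * Real.exp (-(ap * (Real.pi / bp))), by positivity, ?_⟩
      rw [hxm _ ⟨by linarith [ht.1], by linarith [ht.2]⟩, add_sub_cancel_right, smul_neg, smul_smul,
        mul_assoc, ← Real.exp_add, neg_add_cancel, Real.exp_zero, mul_one, ← hqr, neg_neg]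
    · have hq2 : q 2 = l * q 1 := by rw [h] at hq; linarith
      have hqv : q = (-q 1) • ![0, -1, -l] := by
        ext i
        fin_cases i
        · simp [h]
        · simp
        · simp [hq2, mul_comm]
      rcases lt_trichotomy (q 1) 0 with h1 | h1 | h1
      · exact ⟨0, ⟨le_rfl, hTpos.le⟩, -q 1, by linarith, by rw [hx0]; exact hqv⟩
      · exact absurd (by rw [hqv, h1, neg_zero, zero_smul]) hqne
      · refine ⟨Real.pi / bp, ⟨hτp.le, by linarith⟩, q 1 * Real.exp (-(ap * (Real.pi / bp))),
          by positivity, ?_⟩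
        rw [hxτ, smul_neg, smul_smul, mul_assoc, ← Real.exp_add, neg_add_cancel, Real.exp_zero,
          mul_one, ← neg_smul]
        exact hqv
    · obtain ⟨t, ht, r, hr, hqr⟩ := exists_planeSolution_eq hbp l ap h hq
      refine ⟨t, ⟨ht.1.le, by linarith [ht.2]⟩, r, hr, ?_⟩
      rwa [hxp t (Ioo_subset_Icc_self ht)]
  have hmemC : ∀ t ∈ Icc 0 T, ∀ r : ℝ, 0 < r → r • x t ∈ C := by
    intro t ht r hr
    refine (hC _).2 ⟨?_, smul_ne_zero hr.ne' (hxne t)⟩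
    simp only [Pi.smul_apply, smul_eq_mul]
    linear_combination r * hplane t ht
  have hxC : ∀ t ∈ Icc 0 T, x t ∈ C := fun t ht => by simpa using hmemC t ht 1 one_pos
  have hreturn : ∀ t ∈ Ioo 0 T, x t ∉ halfLine (x 0) := by
    rintro t ht ⟨r, hr, h⟩
    have h0 : x t 0 = 0 := by simp [h, hx0]
    have h1 : x t 1 < 0 := by simpa [h, hx0] using hr
    rcases lt_trichotomy t (Real.pi / bp) with h | rfl | h
    · exact (hpos t ⟨ht.1, h⟩).ne' h0
    · rw [hxp _ (right_mem_Icc.2 hτp.le), planeSolution_half_turn hbp] at h1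
      simp only [Pi.neg_apply, Pi.smul_apply, smul_eq_mul, Matrix.cons_val_one,
        Matrix.cons_val_zero, mul_neg, mul_one, neg_neg] at h1
      exact h1.not_gt (Real.exp_pos _)
    · exact (hneg t ⟨h, ht.2⟩).ne h0
  refine ⟨⟨⟨x 0, hxne 0, T, hTpos, ?_, ?_⟩, ⟨x (Real.pi / bp / 2), hxC _ ?_, hpos _ ?_⟩,
    ⟨x (Real.pi / bp + Real.pi / bm / 2), hxC _ ?_, hneg _ ?_⟩⟩, ?_⟩
  · rintro p ⟨r, hr, rfl⟩
    refine ⟨fun t => r • x t, hx.smul hr, rfl,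
      ⟨r * Real.exp (Real.pi * (ap / bp + am / bm)), by positivity, ?_⟩, ?_⟩
    · have := hxT 0
      rw [zero_add] at this
      simp only [this, smul_smul]
    · rintro t ht ⟨s, hs, h⟩
      refine hreturn t ht ⟨r⁻¹ * s, by positivity, ?_⟩
      rw [mul_smul, ← h, inv_smul_smul₀ hr.ne']
  · ext q
    constructor
    · intro hq
      obtain ⟨t, ht, r, hr, rfl⟩ := hcover q hq
      exact ⟨fun t => r • x t, hx.smul hr, ⟨r, hr, rfl⟩, t, ht, rfl⟩
    · rintro ⟨y, hy, ⟨r, hr, hyr⟩, t, ht, rfl⟩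
      subst hAp hAm
      have := hy.eq_smul_shift hx hr (a := 0) (s := 0) (by simpa using hyr) t
      rw [this, add_zero]
      exact hmemC t ht r hr
  · exact ⟨by positivity, by linarith⟩
  · exact ⟨by positivity, by linarith⟩
  · exact ⟨by positivity, by linarith⟩
  · exact ⟨by linarith, by linarith⟩
  -- The rate σ is the logarithm of the growth per turn divided by T, so it has the sign of the sum
  -- α⁺/β⁺ + α⁻/β⁻.
  · have hrate : Real.pi * (ap / bp + am / bm) / T * T = Real.pi * (ap / bp + am / bm) := by
      field_simp
    have := focus_type_of_self_similar (A := Ap) (B := Am) (C := C)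
      (σ := Real.pi * (ap / bp + am / bm) / T) ⟨x, hx, hxC 0 ⟨le_rfl, hTpos.le⟩, hxne 0⟩ ?_
    · rwa [div_eq_zero_iff, or_iff_left hTpos.ne', mul_eq_zero, or_iff_right Real.pi_ne_zero,
        div_lt_iff₀ hTpos, zero_mul, lt_div_iff₀ hTpos, zero_mul, mul_pos_iff_of_pos_left Real.pi_pos,
        ← neg_pos, ← mul_neg, mul_pos_iff_of_pos_left Real.pi_pos, neg_pos] at this
    · intro y hy hyC
      obtain ⟨t, ht, r, hr, hyr⟩ := hcover _ hyC
      have hys : ∀ s, y s = r • x (s + t) := by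
        subst hAp hAm
        exact fun s => hy.eq_smul_shift hx hr (a := 0) (by rw [hyr, zero_add]) s
      refine ⟨T, hTpos, fun s => ?_⟩
      rw [hys, hys, add_right_comm, hxT, smul_comm, hrate]

end

/-! ### Assembly of the two parts -/

theorem corollary4p2 (δp mp dp δm mm dm lp ap bp lm am bm : ℝ)
    (hbp : 0 < bp) (hbm : 0 < bm)
    (hp : HasEigenvalues (obsMatrix δp mp dp) lp ap bp)
    (hm : HasEigenvalues (obsMatrix δm mm dm) lm am bm) :
    (gammaParam lp ap bp = 0 → gammaParam lm am bm = 0 →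
      ((∃ C, IsTwoZonalInvariantCone (obsMatrix δp mp dp) (obsMatrix δm mm dm) C) ↔ lp = lm) ∧
      ∀ C, IsTwoZonalInvariantCone (obsMatrix δp mp dp) (obsMatrix δm mm dm) C →
        (IsCenterOn (obsMatrix δp mp dp) (obsMatrix δm mm dm) C ↔ lp = lm ∧ lm = 0) ∧
        (IsStableFocusOn (obsMatrix δp mp dp) (obsMatrix δm mm dm) C ↔ lp = lm ∧ lm < 0) ∧
        (IsUnstableFocusOn (obsMatrix δp mp dp) (obsMatrix δm mm dm) C ↔ lp = lm ∧ 0 < lm)) ∧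
    (∀ C : Set (Fin 3 → ℝ),
      focusPlane (obsMatrix δp mp dp) ap bp = focusPlane (obsMatrix δm mm dm) am bm →
      C = (focusPlane (obsMatrix δp mp dp) ap bp : Set (Fin 3 → ℝ)) \ {0} →
        IsTwoZonalInvariantCone (obsMatrix δp mp dp) (obsMatrix δm mm dm) C ∧
        (IsCenterOn (obsMatrix δp mp dp) (obsMatrix δm mm dm) C ↔ ap / bp + am / bm = 0) ∧
        (IsStableFocusOn (obsMatrix δp mp dp) (obsMatrix δm mm dm) C ↔ ap / bp + am / bm < 0) ∧
        (IsUnstableFocusOn (obsMatrix δp mp dp) (obsMatrix δm mm dm) C ↔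
          0 < ap / bp + am / bm)) := by
  obtain ⟨rfl, rfl, rfl⟩ := hp.coeffs
  obtain ⟨rfl, rfl, rfl⟩ := hm.coeffs
  constructor
  · intro hgp hgm
    have hap : lp = ap := by
      rw [gammaParam, div_eq_zero_iff, or_iff_left hbp.ne'] at hgp
      linarith
    have ham : lm = am := by
      rw [gammaParam, div_eq_zero_iff, or_iff_left hbm.ne'] at hgm
      linarith
    subst hap ham
    have e1 : ∀ l : ℝ, l + 2 * l = 3 * l := fun l => by ring
    have e2 : ∀ l b : ℝ, 2 * l * l + (l ^ 2 + b ^ 2) = 3 * l ^ 2 + b ^ 2 := fun l b => by ring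
    refine ⟨⟨fun ⟨C, hC⟩ => ?_, ?_⟩, fun C hC => ?_⟩
    · rw [e1, e1, e2, e2] at hC
      exact (cone_dynamics_of_gamma_zero hbp hbm rfl rfl hC).1
    · rintro rfl
      exact ⟨{q | lp ^ 2 * q 0 - lp * q 1 + q 2 = 0 ∧ q ≠ 0},
        (focusPlane_isTwoZonalInvariantCone hbp hbm (fun q => Iff.rfl) rfl rfl).1⟩
    · rw [e1, e1, e2, e2] at hC ⊢
      obtain ⟨hl, h⟩ := cone_dynamics_of_gamma_zero hbp hbm rfl rfl hC
      simpa only [hl, true_and] using h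
  · rintro C heq rfl
    have hl : lp = lm := by
      -- This vector of the first focus plane lies in the second one only if λ⁺ = λ⁻.
      have h1 : (![0, 1, lp] : Fin 3 → ℝ) ∈ focusPlane (obsMatrix (lp + 2 * ap)
          (2 * lp * ap + (ap ^ 2 + bp ^ 2)) (lp * (ap ^ 2 + bp ^ 2))) ap bp := by
        rw [mem_focusPlane]
        simp
      rw [heq, mem_focusPlane] at h1
      simp at h1
      linarith
    subst hl
    exact focusPlane_isTwoZonalInvariantCone (l := lp) hbp hbm
      (fun q => by simp [mem_focusPlane]) rfl rfl
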